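/- Let $H$ be a locally finite simple graph with vertex set $W$ (finite or infinite), and let $\Lambda\subseteq W$ be a finite set such that every vertex of $\Lambda$ is joined in $H$ by a path to some vertex outside $\Lambda$. (For a finite connected graph $H$ one may take $\Lambda=W\setminus\{r\}$ for any root $r$; for a finite subset $\Lambda$ of a lattice $H$, the vertices outside $\Lambda$ play the role of the boundary.) Let $E$ be the set of edges of $H$ with at least one endpoint in $\Lambda$, each given an arbitrary orientation $e=(e^-,e^+)$. Identify all the vertices outside $\Lambda$ to a single vertex, keeping parallel edges. Let $T\subseteq E$ be uniformly distributed on the set of edge sets of spanning trees of the resulting finite multigraph with edge set $E$ (the UST with wired boundary; for $\Lambda=W\setminus\{r\}$ it is the UST of $H$). Let $-\Delta_\Lambda$ be the $\Lambda\times\Lambda$ matrix with $-\Delta_\Lambda(u,u)=\deg_H(u)$, $-\Delta_\Lambda(u,v)=-1$ if $u\sim v$, and $0$ otherwise. Let $G_\Lambda$ be the Dirichlet Green's function, $G_\Lambda=(-\Delta_\Lambda)^{-1}$ on $\Lambda\times\Lambda$ and $0$ elsewhere, and let $$M(f,g)=G_\Lambda(f^+,g^+)-G_\Lambda(f^+,g^-)-G_\Lambda(f^-,g^+)+G_\Lambda(f^-,g^-),\qquad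 f,g\in E,$$ be the transfer-current matrix. Let $\Omega^{2\Lambda}$ be the real Grassmann algebra with generators $\psi_v,\bar\psi_v$, $v\in\Lambda$, put $\psi_v=\bar\psi_v=0$ for $v\notin\Lambda$, and let the fermionic Gaussian free field state be $$\langle X\rangle=\frac1{\det(-\Delta_\Lambda)}\Big(\prod_{v\in\Lambda}\partial_{\bar\psi_v}\partial_{\psi_v}\Big)\exp\Big(\sum_{u,v\in\Lambda}\psi_u\,(-\Delta_\Lambda)(u,v)\,\bar\psi_v\Big)X,\qquad X\in\Omega^{2\Lambda},$$ with left Grassmann derivatives. For $e\in E$ let $\zeta(e)=(\psi_{e^+}-\psi_{e^-})(\bar\psi_{e^+}-\bar\psi_{e^-})$; these elements commute. Then, for all $F,G\subseteq E$ with $F\cap G=\emptyset$, $$\mathbb P(F\subseteq T,\ G\cap T=\emptyset)=\Big\langle\prod_{f\in F}\zeta(f)\prod_{g\in G}(1-\zeta(g))\Big\rangle=\det\big(M^{(|F|)}\big),$$ where, the edges of $F\cup G$ being numbered $1,\dots,|F|+|G|$ with those of $F$ first, $$M^{(|F|)}(i,j)=\begin{cases}M(i,j)&\text{if } i\le|F|,\\-M(i,j)&\text{if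 } i>|F|,\ i\ne j,\\1-M(i,j)&\text{if } i>|F|,\ i=j.\end{cases}$$ -/

import Mathlib

namespace FermionicUST

noncomputable section

variable {W : Type*} [DecidableEq W] (H : SimpleGraph W) (Λ : Finset W)

/-! ### Edges of `Λ` and the uniform spanning tree with wired boundary -/

/-- `E(Λ)`: the undirected edges of the ambient graph `H` with at least one endpoint in `Λ`. -/
abbrev Edge : Type _ := {e : Sym2 W // e ∈ H.edgeSet ∧ ∃ v ∈ Λ, v ∈ e}

/-- Wiring of the boundary: vertices of `Λ` are kept, all the others are identified
to the single vertex `none`. -/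
def wire (v : W) : Option Λ := if h : v ∈ Λ then some ⟨v, h⟩ else none

/-- The simple graph underlying the wired multigraph with edge set `T`. -/
def wiredGraph (T : Set (Edge H Λ)) : SimpleGraph (Option Λ) where
  Adj a b := a ≠ b ∧ ∃ e ∈ T, e.1.map (wire Λ) = s(a, b)
  symm := ⟨fun _ _ h => ⟨h.1.symm, by simpa only [Sym2.eq_swap] using h.2⟩⟩
  loopless := ⟨fun _ h => h.1 rfl⟩

/-- A set `T` of edges is a spanning tree of the wired multigraph when no two of its edges are
parallel and the simple graph that they form on all vertices is a tree. (An edge of `E(Λ)` never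
becomes a loop, having an endpoint in `Λ`.) -/
def IsWiredSpanningTree (T : Set (Edge H Λ)) : Prop :=
  Set.InjOn (fun e : Edge H Λ => e.1.map (wire Λ)) T ∧ (wiredGraph H Λ T).IsTree

/-- The law of the uniform spanning tree with wired boundary. -/
def ust : MeasureTheory.Measure (Set (Edge H Λ)) :=
  ProbabilityTheory.uniformOn {T | IsWiredSpanningTree H Λ T}

/-! ### Laplacian, Green's function, transfer-current matrix -/

/-- The discrete Laplacian `Δ(u, v)` of the ambient graph. -/
def laplacian [DecidableRel H.Adj] [H.LocallyFinite] (u v : W) : ℝ :=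
  if u = v then -(H.degree u : ℝ) else if H.Adj u v then 1 else 0

/-- `-Δ_Λ`, minus the restriction of the Laplacian to `Λ`. -/
def negLaplacian [DecidableRel H.Adj] [H.LocallyFinite] : Matrix Λ Λ ℝ :=
  Matrix.of fun u v => -laplacian H u v

/-- The Green's function with Dirichlet boundary conditions: the inverse of `-Δ_Λ`,
extended by zero. -/
def green [DecidableRel H.Adj] [H.LocallyFinite] (u v : W) : ℝ :=
  if h : u ∈ Λ ∧ v ∈ Λ then (negLaplacian H Λ)⁻¹ ⟨u, h.1⟩ ⟨v, h.2⟩ else 0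

/-- The defining equation `-Δ_Λ G_Λ(u, ·) = δ_u` on `Λ`. -/
theorem negLaplacian_green [DecidableRel H.Adj] [H.LocallyFinite]
    (hdet : (negLaplacian H Λ).det ≠ 0) (u v : Λ) :
    ∑ w : Λ, negLaplacian H Λ v w * green H Λ u w = if u = v then 1 else 0 := by
  have hT : (negLaplacian H Λ).transpose = negLaplacian H Λ := by
    ext a b
    simp only [Matrix.transpose_apply, negLaplacian, Matrix.of_apply, laplacian, H.adj_comm (a : W)]
    by_cases hab : (a : W) = b
    · rw [hab]
    · simp [hab, Ne.symm hab]
  have h := congrFun (congrFun (Matrix.nonsing_inv_mul _ (isUnit_iff_ne_zero.mpr hdet)) u) v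
  rw [Matrix.mul_apply, Matrix.one_apply] at h
  rw [← h]
  refine Finset.sum_congr rfl fun w _ => ?_
  have hs : negLaplacian H Λ v w = negLaplacian H Λ w v := by
    conv_lhs => rw [← hT]
    rfl
  simp [green, hs, mul_comm]

/-- The transfer-current matrix `M(f, g) = ∇_f^{(1)} ∇_g^{(2)} G_Λ(f⁻, g⁻)` for oriented edges. -/
def transferCurrent [DecidableRel H.Adj] [H.LocallyFinite] (f g : H.Dart) : ℝ :=
  green H Λ f.snd g.snd - green H Λ f.snd g.fst
    - green H Λ f.fst g.snd + green H Λ f.fst g.fst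

/-- The matrix `M^{(|F|)}`, indexed by `F` followed by `G`; the edges are oriented by `o`. -/
def modifiedTransferCurrent [DecidableRel H.Adj] [H.LocallyFinite] (o : Edge H Λ → H.Dart)
    (F G : Finset (Edge H Λ)) : Matrix (F ⊕ G) (F ⊕ G) ℝ :=
  Matrix.of fun i j =>
    let M : ℝ := transferCurrent H Λ (o (Sum.elim Subtype.val Subtype.val i))
      (o (Sum.elim Subtype.val Subtype.val j))
    if i.isLeft then M else if i = j then 1 - M else -M

/-! ### Grassmann algebra and the fermionic Gaussian free field -/

/-- The Grassmann algebra `Ω^{2Λ}` over `ℝ`, with two generators for each vertex of `Λ`. -/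
abbrev Grassmann : Type _ := ExteriorAlgebra ℝ (Λ ⊕ Λ → ℝ)

variable {Λ} in
/-- The generators: `gen (inl v) = ψ_v` and `gen (inr v) = ψ̄_v`. -/
def gen (i : Λ ⊕ Λ) : Grassmann Λ := ExteriorAlgebra.ι ℝ (Pi.single i 1)

variable {Λ} in
/-- The (left) Grassmann derivative with respect to a generator: the linear map that kills `1` and
satisfies `∂_i (ξ_j x) = δ_{ij} x - ξ_j ∂_i x`. -/
def grassmannDeriv (i : Λ ⊕ Λ) : Module.End ℝ (Grassmann Λ) :=
  CliffordAlgebra.contractLeft (LinearMap.proj i : Module.Dual ℝ (Λ ⊕ Λ → ℝ))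

variable {Λ} in
theorem grassmannDeriv_one (i : Λ ⊕ Λ) : grassmannDeriv i (1 : Grassmann Λ) = 0 :=
  CliffordAlgebra.contractLeft_one _ _

variable {Λ} in
theorem grassmannDeriv_gen_mul (i j : Λ ⊕ Λ) (x : Grassmann Λ) :
    grassmannDeriv i (gen j * x) = (if i = j then x else 0) - gen j * grassmannDeriv i x := by
  refine (CliffordAlgebra.contractLeft_ι_mul _ _ _).trans ?_
  rw [LinearMap.proj_apply, Pi.single_apply, ite_smul, one_smul, zero_smul]
  rfl

variable {Λ} in
theorem grassmannDeriv_comm (i j : Λ ⊕ Λ) : grassmannDeriv i * grassmannDeriv j = -(grassmannDeriv j * grassmannDeriv i) :=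
  LinearMap.ext fun x => CliffordAlgebra.contractLeft_comm _ _ x

theorem commute_of_anticomm {R : Type*} [Ring R] {a b c d : R} (hac : a * c = -(c * a))
    (had : a * d = -(d * a)) (hbc : b * c = -(c * b)) (hbd : b * d = -(d * b)) :
    Commute (a * b) (c * d) := by
  have h₁ : a * b * c = c * (a * b) := by
    rw [mul_assoc, hbc, mul_neg, ← mul_assoc, hac, neg_mul, neg_neg, mul_assoc]
  have h₂ : a * b * d = d * (a * b) := by
    rw [mul_assoc, hbd, mul_neg, ← mul_assoc, had, neg_mul, neg_neg, mul_assoc]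
  change a * b * (c * d) = c * d * (a * b)
  rw [← mul_assoc, h₁, mul_assoc c, h₂, mul_assoc]

/-- The Grassmann–Berezin integration `∏_{v ∈ Λ} ∂_{ψ̄_v} ∂_{ψ_v}` (the factors commute). -/
def berezin : Module.End ℝ (Grassmann Λ) :=
  Finset.univ.noncommProd
    (fun v : Λ => grassmannDeriv (Sum.inr v : Λ ⊕ Λ) * grassmannDeriv (Sum.inl v : Λ ⊕ Λ))
    fun _ _ _ _ _ =>
      commute_of_anticomm (grassmannDeriv_comm _ _) (grassmannDeriv_comm _ _) (grassmannDeriv_comm _ _) (grassmannDeriv_comm _ _)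

/-- The quadratic form `⟨ψ, -Δ_Λ ψ̄⟩ = ∑_{u, v ∈ Λ} ψ_u (-Δ_Λ)(u, v) ψ̄_v`. -/
def fermionicAction [DecidableRel H.Adj] [H.LocallyFinite] : Grassmann Λ :=
  ∑ u : Λ, ∑ v : Λ, negLaplacian H Λ u v • (gen (Sum.inl u) * gen (Sum.inr v))

/-- The normalized fermionic Gaussian free field state. -/
def fGFF [DecidableRel H.Adj] [H.LocallyFinite] (X : Grassmann Λ) : ℝ :=
  (negLaplacian H Λ).det⁻¹ *
    ExteriorAlgebra.algebraMapInv (berezin Λ (IsNilpotent.exp (fermionicAction H Λ) * X))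

/-- `ψ_v`, with Dirichlet boundary condition `ψ_v = 0` for `v ∉ Λ`. -/
def psi (v : W) : Grassmann Λ := if h : v ∈ Λ then gen (Sum.inl ⟨v, h⟩) else 0

/-- `ψ̄_v`, with Dirichlet boundary condition `ψ̄_v = 0` for `v ∉ Λ`. -/
def psiBar (v : W) : Grassmann Λ := if h : v ∈ Λ then gen (Sum.inr ⟨v, h⟩) else 0

/-- `ζ(e) = ∇_e ψ(e⁻) ∇_e ψ̄(e⁻)` for an oriented edge `e`. -/
def zeta (e : H.Dart) : Grassmann Λ :=
  (psi Λ e.snd - psi Λ e.fst) * (psiBar Λ e.snd - psiBar Λ e.fst)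

theorem psi_eq_ι (v : W) : ∃ x, psi Λ v = ExteriorAlgebra.ι ℝ x := by
  by_cases h : v ∈ Λ
  · exact ⟨_, by rw [psi, dif_pos h, gen]⟩
  · exact ⟨0, by rw [psi, dif_neg h, map_zero]⟩

theorem psiBar_eq_ι (v : W) : ∃ x, psiBar Λ v = ExteriorAlgebra.ι ℝ x := by
  by_cases h : v ∈ Λ
  · exact ⟨_, by rw [psiBar, dif_pos h, gen]⟩
  · exact ⟨0, by rw [psiBar, dif_neg h, map_zero]⟩

/-- The elements `ζ(e)` commute with each other. -/
theorem zeta_commute (a b : H.Dart) : Commute (zeta H Λ a) (zeta H Λ b) := by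
  have key : ∀ e : H.Dart, ∃ x y, zeta H Λ e = ExteriorAlgebra.ι ℝ x * ExteriorAlgebra.ι ℝ y := by
    intro e
    obtain ⟨x₁, h₁⟩ := psi_eq_ι Λ e.snd
    obtain ⟨x₂, h₂⟩ := psi_eq_ι Λ e.fst
    obtain ⟨y₁, k₁⟩ := psiBar_eq_ι Λ e.snd
    obtain ⟨y₂, k₂⟩ := psiBar_eq_ι Λ e.fst
    exact ⟨x₁ - x₂, y₁ - y₂, by rw [zeta, h₁, h₂, k₁, k₂, map_sub, map_sub]⟩
  obtain ⟨x, y, h⟩ := key a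
  obtain ⟨z, w, k⟩ := key b
  rw [h, k]
  have anti : ∀ p q : Λ ⊕ Λ → ℝ, ExteriorAlgebra.ι ℝ p * ExteriorAlgebra.ι ℝ q
      = -(ExteriorAlgebra.ι ℝ q * ExteriorAlgebra.ι ℝ p) :=
    fun p q => eq_neg_of_add_eq_zero_left (ExteriorAlgebra.ι_add_mul_swap p q)
  exact commute_of_anticomm (anti _ _) (anti _ _) (anti _ _) (anti _ _)

/-- The observable `∏_{f ∈ F} ζ(f) ∏_{g ∈ G} (1 - ζ(g))`; the edges are oriented by `o`. -/
def yesNoObservable (o : Edge H Λ → H.Dart) (F G : Finset (Edge H Λ)) : Grassmann Λ :=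
  F.noncommProd (fun f => zeta H Λ (o f)) (fun _ _ _ _ _ => zeta_commute H Λ _ _) *
  G.noncommProd (fun g => 1 - zeta H Λ (o g)) fun _ _ _ _ _ =>
    (Commute.one_left _).sub_left ((Commute.one_right _).sub_right (zeta_commute H Λ _ _))

end

end FermionicUST

open FermionicUST

/-!
# Fermionic observables of the uniform spanning tree

Fix the edges `F` to be present and the edges `G` to be absent. The probability, the fermionic
expectation and the determinant are all additive in the same way: for an edge `f` outside `F ∪ G`,
the values at `(F ∪ {f}, G)` and `(F, G ∪ {f})` add up to the value at `(F, G)`. A tree either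
contains `f` or not (`treeCount_insert`), `ζ(f)` and `1 - ζ(f)` add up to `1`
(`yesNoObservable_insert`), and the determinant is linear in row `f` (`det_yesNoMatrix_insert`). So
it is enough to treat `F = ∅` (`eq_of_insert_recursion`), where each of the three quantities is
`det (Bᵀ D B) / det (Bᵀ B)`. Here `B` is the signed incidence matrix, for which
`-Δ_Λ = Bᵀ B` (`negLaplacian_eq`), and `D` is the diagonal projection onto the complement of `G`.

* Determinant: `M = B (-Δ_Λ)⁻¹ Bᵀ` (`transferCurrent_eq`), and the Weinstein–Aronszajn identity
  gives `det (1 - D_G M) = det (-Δ_Λ - Bᵀ D_G B) / det (-Δ_Λ)` (`det_yesNoMatrix_empty`).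
* Fermions: the action is the sum of all `ζ(e)`, and `1 - ζ(g) = exp (-ζ(g))` because `ζ(g)² = 0`.
  The observable therefore removes the edges `G` from the action
  (`exp_mul_yesNoObservable_empty`). The Gaussian integral `∫ exp (ψ C ψ̄) = det C`
  (`berezin_exp_action`) holds because the left side is an alternating multilinear function of the
  rows of `C` with value `1` at the identity.
* Trees: this is the matrix-tree theorem for the graph without `G` (`det_eq_card_spanningTrees`).
  By Cauchy–Binet (`det_transpose_diagInd_mul`) the determinant is the sum of the squares of the
  maximal minors of `B`. If the chosen edges connect the wired graph, paths to the root provide an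
  inverse of the minor over `ℤ`, so its determinant is `±1`; otherwise the vertices that are not
  joined to the root support a kernel vector. A connected choice of `|Λ|` edges is a spanning tree.

Finally `det (-Δ_Λ) ≠ 0`, since a function in the kernel is constant along paths of `H` and vanishes
outside `Λ` (`det_negLaplacian_ne_zero`).
-/

namespace FermionicUST

noncomputable section

/-! ### Exponentials of sums of commuting square-zero elements -/

theorem exp_of_sq_eq_zero {R : Type*} [Ring R] [Module ℚ R] {a : R} (h : a * a = 0) :
    IsNilpotent.exp a = 1 + a := by
  rw [IsNilpotent.exp_eq_sum (k := 2) (by rw [pow_two, h])]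
  simp [Finset.sum_range_succ]

theorem commute_one_add {R : Type*} [Ring R] {a b : R} (h : Commute a b) :
    Commute (1 + a) (1 + b) :=
  (Commute.one_left _).add_left ((Commute.one_right _).add_right h)

theorem isNilpotent_of_sq_eq_zero {R : Type*} [Ring R] {a : R} (h : a * a = 0) :
    IsNilpotent a := ⟨2, by rw [pow_two, h]⟩

theorem exp_sum_eq_noncommProd {R ι : Type*} [Ring R] [Algebra ℚ R] (a : ι → R)
    (hc : ∀ i j, Commute (a i) (a j)) (h : ∀ i, a i * a i = 0) (s : Finset ι)
    (comm : (s : Set ι).Pairwise (Function.onFun Commute fun i => 1 + a i)) :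
    IsNilpotent.exp (∑ i ∈ s, a i) = s.noncommProd (fun i => 1 + a i) comm := by
  classical
  induction s using Finset.induction_on with
  | empty => simp [exp_of_sq_eq_zero (R := R) (mul_zero 0)]
  | insert i s hi ih =>
    rw [Finset.sum_insert hi, Finset.noncommProd_insert_of_notMem _ _ _ _ hi,
      IsNilpotent.exp_add_of_commute (Commute.sum_right _ _ _ fun j _ => hc i j)
        (isNilpotent_of_sq_eq_zero (h i))
        (Commute.isNilpotent_sum (fun j _ => isNilpotent_of_sq_eq_zero (h j))
          fun j k _ _ => hc j k),
      exp_of_sq_eq_zero (h i), ih]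

/-! ### Berezin integral of a Gaussian -/

section

variable {W : Type*} {Λ : Finset W}

open ExteriorAlgebra in
theorem ι_mul_ι_anticomm (p q : Λ ⊕ Λ → ℝ) :
    (ι ℝ p * ι ℝ q : Grassmann Λ) = -(ι ℝ q * ι ℝ p) :=
  eq_neg_of_add_eq_zero_left (ι_add_mul_swap p q)

open ExteriorAlgebra in
theorem commute_ι_mul_ι (p q r s : Λ ⊕ Λ → ℝ) :
    Commute (ι ℝ p * ι ℝ q : Grassmann Λ) (ι ℝ r * ι ℝ s) :=
  commute_of_anticomm (ι_mul_ι_anticomm _ _) (ι_mul_ι_anticomm _ _) (ι_mul_ι_anticomm _ _)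
    (ι_mul_ι_anticomm _ _)

open ExteriorAlgebra in
theorem ι_mul_ι_sq (p q : Λ ⊕ Λ → ℝ) :
    (ι ℝ p * ι ℝ q * (ι ℝ p * ι ℝ q) : Grassmann Λ) = 0 := by
  rw [mul_assoc, ← mul_assoc (ι ℝ q), ι_mul_ι_anticomm q p, neg_mul, mul_assoc, ι_sq_zero]
  simp

theorem grassmannDeriv_ι_mul (i : Λ ⊕ Λ) (p : Λ ⊕ Λ → ℝ) (x : Grassmann Λ) :
    grassmannDeriv i (ExteriorAlgebra.ι ℝ p * x) =
      p i • x - ExteriorAlgebra.ι ℝ p * grassmannDeriv i x :=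
  CliffordAlgebra.contractLeft_ι_mul _ _ _

theorem grassmannDeriv_ι_mul_ι_mul {i : Λ ⊕ Λ} {p q : Λ ⊕ Λ → ℝ} (hp : p i = 0) (hq : q i = 0)
    (x : Grassmann Λ) :
    grassmannDeriv i (ExteriorAlgebra.ι ℝ p * ExteriorAlgebra.ι ℝ q * x) =
      ExteriorAlgebra.ι ℝ p * ExteriorAlgebra.ι ℝ q * grassmannDeriv i x := by
  rw [mul_assoc, grassmannDeriv_ι_mul, grassmannDeriv_ι_mul, hp, hq]
  simp [mul_assoc]

/-- The element `∑_v r_v ψ̄_v` of the Grassmann algebra. -/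
def psiBarForm (r : Λ → ℝ) : Grassmann Λ := ExteriorAlgebra.ι ℝ (Sum.elim 0 r)

theorem psiBarForm_add (r s : Λ → ℝ) :
    psiBarForm (r + s) = psiBarForm r + psiBarForm s := by
  rw [psiBarForm, psiBarForm, psiBarForm, ← map_add]
  congr 1
  ext (i | i) <;> simp

theorem psiBarForm_smul (c : ℝ) (r : Λ → ℝ) : psiBarForm (c • r) = c • psiBarForm r := by
  rw [psiBarForm, psiBarForm, ← map_smul]
  congr 1
  ext (i | i) <;> simp

theorem psiBarForm_sum {κ : Type*} (s : Finset κ) (r : κ → Λ → ℝ) :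
    psiBarForm (∑ k ∈ s, r k) = ∑ k ∈ s, psiBarForm (r k) :=
  map_sum (AddMonoidHom.mk' (psiBarForm (Λ := Λ)) psiBarForm_add) _ _

variable [DecidableEq W]

/-- A product of factors `1 + p q` in whose linear forms a generator does not occur is killed by
the derivative with respect to that generator. -/
theorem grassmannDeriv_noncommProd_eq_zero {κ : Type*} {i : Λ ⊕ Λ} (p q : κ → Λ ⊕ Λ → ℝ)
    (s : Finset κ) (hp : ∀ k ∈ s, p k i = 0) (hq : ∀ k ∈ s, q k i = 0)
    (comm : (s : Set κ).Pairwise (Function.onFun Commute fun k =>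
      (1 + ExteriorAlgebra.ι ℝ (p k) * ExteriorAlgebra.ι ℝ (q k) : Grassmann Λ))) :
    grassmannDeriv i (s.noncommProd
      (fun k => (1 + ExteriorAlgebra.ι ℝ (p k) * ExteriorAlgebra.ι ℝ (q k) : Grassmann Λ))
      comm) = 0 := by
  classical
  induction s using Finset.induction_on with
  | empty => rw [Finset.noncommProd_empty, grassmannDeriv_one]
  | insert k s hk ih =>
    rw [Finset.noncommProd_insert_of_notMem _ _ _ _ hk, add_mul, one_mul, map_add,
      grassmannDeriv_ι_mul_ι_mul (hp k (by simp)) (hq k (by simp)),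
      ih (fun j hj => hp j (by simp [hj])) (fun j hj => hq j (by simp [hj]))]
    simp

/-- The Berezin integral vanishes on elements in which some `ψ_v` does not occur. -/
theorem berezin_eq_zero_of_grassmannDeriv_inl {x : Grassmann Λ} (v : Λ)
    (h : grassmannDeriv (Sum.inl v) x = 0) : berezin Λ x = 0 := by
  have hb : berezin Λ = _ * (grassmannDeriv (Sum.inr v) * grassmannDeriv (Sum.inl v)) :=
    (Finset.noncommProd_erase_mul _ (Finset.mem_univ v) _ _).symm
  rw [hb, Module.End.mul_apply, Module.End.mul_apply, h, map_zero, map_zero]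

theorem psiBarForm_single (v : Λ) : psiBarForm (Pi.single v 1) = gen (Sum.inr v) := by
  rw [psiBarForm, gen]
  congr 1
  ext (i | i) <;> simp [Pi.single_apply]

theorem commute_gen_mul_psiBarForm (u v : Λ) (r s : Λ → ℝ) :
    Commute (gen (Sum.inl u) * psiBarForm r) (gen (Sum.inl v) * psiBarForm s) :=
  commute_ι_mul_ι _ _ _ _

/-- The product `∏_{u ∈ s} (1 + ψ_u ∑_v C(u, v) ψ̄_v)`. -/
def gaussianProd (C : Matrix Λ Λ ℝ) (s : Finset Λ) : Grassmann Λ :=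
  s.noncommProd (fun u => 1 + gen (Sum.inl u) * psiBarForm (C u))
    (fun _ _ _ _ _ => commute_one_add (commute_gen_mul_psiBarForm _ _ _ _))

theorem gaussianProd_insert (C : Matrix Λ Λ ℝ) {s : Finset Λ} {u : Λ} (hu : u ∉ s) :
    gaussianProd C (insert u s) =
      (1 + gen (Sum.inl u) * psiBarForm (C u)) * gaussianProd C s :=
  Finset.noncommProd_insert_of_notMem _ _ _ _ hu

theorem gaussianProd_congr {C D : Matrix Λ Λ ℝ} {s : Finset Λ} (h : ∀ u ∈ s, C u = D u) :
    gaussianProd C s = gaussianProd D s :=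
  Finset.noncommProd_congr rfl (fun u hu => by rw [h u hu]) _

theorem grassmannDeriv_inl_gaussianProd (C : Matrix Λ Λ ℝ) {s : Finset Λ} {u : Λ} (hu : u ∉ s) :
    grassmannDeriv (Sum.inl u) (gaussianProd C s) = 0 :=
  grassmannDeriv_noncommProd_eq_zero (fun v => Pi.single (Sum.inl v) 1)
    (fun v => Sum.elim 0 (C v)) s
    (fun v hv => by rw [Pi.single_apply, if_neg]; rintro ⟨⟩; exact hu hv) (fun v hv => rfl) _

/-- The constant term in row `u` does not contribute, since it leaves no `ψ_u`. -/
theorem berezin_gaussianProd_univ (C : Matrix Λ Λ ℝ) (u : Λ) :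
    berezin Λ (gaussianProd C Finset.univ) =
      berezin Λ (gen (Sum.inl u) * psiBarForm (C u) * gaussianProd C (Finset.univ.erase u)) := by
  rw [← Finset.insert_erase (Finset.mem_univ u), gaussianProd_insert _ (by simp), add_mul, one_mul,
    map_add, berezin_eq_zero_of_grassmannDeriv_inl u
      (grassmannDeriv_inl_gaussianProd C (Finset.notMem_erase u _)), zero_add]
  simp

theorem berezin_gaussianProd_update (C : Matrix Λ Λ ℝ) (u : Λ) (r : Λ → ℝ) :
    berezin Λ (gaussianProd (C.updateRow u r) Finset.univ) =
      berezin Λ (gen (Sum.inl u) * psiBarForm r * gaussianProd C (Finset.univ.erase u)) := by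
  rw [berezin_gaussianProd_univ _ u, Matrix.updateRow_self]
  congr 2
  exact gaussianProd_congr fun v hv => Matrix.updateRow_ne (Finset.ne_of_mem_erase hv)

/-- If two rows of `C` agree, the Berezin integral vanishes: the product of the two quadratic terms
contains the square of a linear form, and every other term lacks one of the two generators. -/
theorem berezin_gaussianProd_eq_zero (C : Matrix Λ Λ ℝ) {u v : Λ} (hC : C u = C v) (huv : u ≠ v) :
    berezin Λ (gaussianProd C Finset.univ) = 0 := by
  have hv : v ∈ Finset.univ.erase u := by simp [huv.symm]
  set R := gaussianProd C ((Finset.univ.erase u).erase v) with hR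
  rw [berezin_gaussianProd_univ _ u, ← Finset.insert_erase hv, gaussianProd_insert _ (by simp),
    ← hR, ← mul_assoc, mul_add, mul_one, add_mul, map_add]
  have h0 : gen (Sum.inl u) * psiBarForm (C u) * (gen (Sum.inl v) * psiBarForm (C v)) = 0 := by
    rw [hC, psiBarForm, gen, gen, mul_assoc, ← mul_assoc (ExteriorAlgebra.ι ℝ (Sum.elim _ _)),
      ι_mul_ι_anticomm (Sum.elim _ _), neg_mul, mul_assoc, ExteriorAlgebra.ι_sq_zero]
    simp
  rw [h0, zero_mul, map_zero, add_zero]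
  refine berezin_eq_zero_of_grassmannDeriv_inl v ?_
  rw [gen, psiBarForm, grassmannDeriv_ι_mul_ι_mul (by simp [huv.symm]) rfl, hR,
    grassmannDeriv_inl_gaussianProd _ (by simp), mul_zero]

/-- Normalization of the Berezin integral, for an arbitrary set of vertices to allow induction. -/
theorem noncommProd_grassmannDeriv_gaussianProd_one (s : Finset Λ)
    (comm : (s : Set Λ).Pairwise (Function.onFun Commute fun v =>
      grassmannDeriv (Sum.inr v : Λ ⊕ Λ) * grassmannDeriv (Sum.inl v : Λ ⊕ Λ))) :
    s.noncommProd
      (fun v => grassmannDeriv (Sum.inr v : Λ ⊕ Λ) * grassmannDeriv (Sum.inl v : Λ ⊕ Λ)) comm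
      (gaussianProd 1 s) = 1 := by
  induction s using Finset.induction_on with
  | empty =>
    have h : gaussianProd (1 : Matrix Λ Λ ℝ) ∅ = 1 := Finset.noncommProd_empty _ _
    rw [h, Finset.noncommProd_empty, Module.End.one_apply]
  | insert u s hu ih =>
    have hl : grassmannDeriv (Sum.inl u) (gaussianProd 1 s) = 0 :=
      grassmannDeriv_inl_gaussianProd _ hu
    have hr : grassmannDeriv (Sum.inr u) (gaussianProd 1 s) = 0 :=
      grassmannDeriv_noncommProd_eq_zero (i := Sum.inr u) (fun v => Pi.single (Sum.inl v) 1)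
        (fun v => Sum.elim 0 ((1 : Matrix Λ Λ ℝ) v)) s (fun v hv => by simp)
        (fun v hv => Matrix.one_apply_ne (ne_of_mem_of_not_mem hv hu)) _
    have h1 : psiBarForm ((1 : Matrix Λ Λ ℝ) u) = gen (Sum.inr u) := by
      rw [← psiBarForm_single]
      congr 1
      ext v
      simp [Matrix.one_apply, Pi.single_apply, eq_comm]
    rw [Finset.noncommProd_insert_of_notMem' _ _ _ _ hu, gaussianProd_insert _ hu, h1,
      Module.End.mul_apply, Module.End.mul_apply, add_mul, one_mul, map_add, hl, zero_add,
      mul_assoc, grassmannDeriv_gen_mul, if_pos rfl, grassmannDeriv_gen_mul, hl]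
    rw [map_sub, grassmannDeriv_gen_mul, if_pos rfl, hr]
    simpa using ih _

theorem berezin_gaussianProd_one : berezin Λ (gaussianProd 1 Finset.univ) = 1 :=
  noncommProd_grassmannDeriv_gaussianProd_one _ _

/-- The Berezin integral of a Gaussian product, as an alternating function of the rows. -/
def berezinAlternating : (Λ → ℝ) [⋀^Λ]→ₗ[ℝ] ℝ where
  toFun C := ExteriorAlgebra.algebraMapInv (berezin Λ (gaussianProd (Matrix.of C) Finset.univ))
  map_update_add' := by
    intro inst C u x y
    -- the update in a multilinear map uses an arbitrary decidability instance
    obtain rfl : inst = fun a b => Subtype.instDecidableEq a b := Subsingleton.elim _ _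
    have h (r : Λ → ℝ) : berezin Λ (gaussianProd (Matrix.of (Function.update C u r)) _) = _ :=
      berezin_gaussianProd_update (Matrix.of C) u r
    rw [h, h, h, psiBarForm_add, mul_add, add_mul, map_add, map_add]
  map_update_smul' := by
    intro inst C u c x
    obtain rfl : inst = fun a b => Subtype.instDecidableEq a b := Subsingleton.elim _ _
    have h (r : Λ → ℝ) : berezin Λ (gaussianProd (Matrix.of (Function.update C u r)) _) = _ :=
      berezin_gaussianProd_update (Matrix.of C) u r
    rw [h, h, psiBarForm_smul, mul_smul_comm, smul_mul_assoc, map_smul, map_smul]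
  map_eq_zero_of_eq' C u v h huv := by
    rw [berezin_gaussianProd_eq_zero (Matrix.of C) h huv, map_zero]

/-- An alternating multilinear function of the rows is determined by its value at the identity. -/
theorem berezin_gaussianProd (C : Matrix Λ Λ ℝ) :
    ExteriorAlgebra.algebraMapInv (berezin Λ (gaussianProd C Finset.univ)) = C.det := by
  have h := (berezinAlternating (Λ := Λ)).eq_smul_basis_det (Pi.basisFun ℝ Λ)
  have h1 : berezinAlternating (Λ := Λ) (Pi.basisFun ℝ Λ) = 1 := by
    have : (Matrix.of (Pi.basisFun ℝ Λ) : Matrix Λ Λ ℝ) = 1 := by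
      ext u v
      simp [Matrix.one_apply, Pi.single_apply, eq_comm]
    change ExteriorAlgebra.algebraMapInv (berezin Λ (gaussianProd (Matrix.of _) _)) = 1
    rw [this, berezin_gaussianProd_one, map_one]
  rw [h1, one_smul, Pi.basisFun_det] at h
  exact DFunLike.congr_fun h C

/-- The action `∑_{u, v} ψ_u C(u, v) ψ̄_v`. -/
def action (C : Matrix Λ Λ ℝ) : Grassmann Λ :=
  ∑ u : Λ, ∑ v : Λ, C u v • (gen (Sum.inl u) * gen (Sum.inr v))

theorem action_eq_sum_psiBarForm (C : Matrix Λ Λ ℝ) :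
    action C = ∑ u : Λ, gen (Sum.inl u) * psiBarForm (C u) := by
  refine Finset.sum_congr rfl fun u _ => ?_
  have h : C u = ∑ v, C u v • Pi.single v 1 := by
    ext w
    simp [Pi.single_apply]
  rw [h, psiBarForm_sum, Finset.mul_sum]
  refine Finset.sum_congr rfl fun v _ => ?_
  rw [← h, psiBarForm_smul, psiBarForm_single, mul_smul_comm]

/-- The Gaussian Berezin integral `∫ exp(ψ C ψ̄) = det C`. -/
theorem berezin_exp_action (C : Matrix Λ Λ ℝ) :
    ExteriorAlgebra.algebraMapInv (berezin Λ (IsNilpotent.exp (action C))) = C.det := by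
  rw [← berezin_gaussianProd, action_eq_sum_psiBarForm, exp_sum_eq_noncommProd]
  · rfl
  · exact fun u v => commute_gen_mul_psiBarForm _ _ _ _
  · exact fun u => ι_mul_ι_sq _ _

end

/-! ### The Cauchy–Binet formula -/

open Matrix

/-- The diagonal projection onto the coordinates in `S`. -/
def diagInd {E : Type*} [DecidableEq E] (S : Finset E) : Matrix E E ℝ :=
  diagonal fun e => if e ∈ S then 1 else 0

section

variable {E n : Type*} [Fintype n] [DecidableEq n] [DecidableEq E]

/-- The terms of the multilinear expansion of `det (Bᵀ B)` in which the rows `T` of `B` are chosen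
add up to the square of the minor on `T`: they differ from one another by a permutation. -/
theorem sum_injective_image_eq (B : Matrix E n ℝ) (T : Finset E)
    (hT : T.card = Fintype.card n) (A : Finset (n → E))
    (hA : ∀ f, f ∈ A ↔ Function.Injective f ∧ Finset.univ.image f = T)
    (w : ℝ) (hw : ∀ f ∈ A, (B.submatrix f id).det ^ 2 = w) :
    ∑ f ∈ A, (∏ u, B (f u) u) * (B.submatrix f id).det = w := by
  obtain ⟨g⟩ : Nonempty (n ≃ T) := Fintype.card_eq.mp (by simp [hT])
  set f₀ : n → E := fun u => g u with hf₀
  have hinj : Function.Injective f₀ := Subtype.val_injective.comp g.injective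
  have himg : Finset.univ.image f₀ = T := by
    ext e
    simp only [Finset.mem_image, Finset.mem_univ, true_and, hf₀]
    refine ⟨?_, fun he => ⟨g.symm ⟨e, he⟩, by simp⟩⟩
    rintro ⟨u, rfl⟩
    exact (g u).2
  have hA0 : f₀ ∈ A := (hA f₀).mpr ⟨hinj, himg⟩
  have key : ∑ f ∈ A, (∏ u, B (f u) u) * (B.submatrix f id).det =
      ∑ σ : Equiv.Perm n, (∏ u, B (f₀ (σ u)) u) * (B.submatrix (f₀ ∘ σ) id).det := by
    symm
    refine Finset.sum_bij (fun σ _ => f₀ ∘ σ) ?_ ?_ ?_ ?_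
    · intro σ _
      refine (hA _).mpr ⟨hinj.comp σ.injective, ?_⟩
      rw [← himg, ← Finset.image_image, Finset.image_univ_equiv]
    · intro σ _ τ _ h
      exact Equiv.ext fun u => hinj (congrFun h u)
    · intro f hf
      obtain ⟨hfi, hfT⟩ := (hA f).mp hf
      have hmem (u : n) : f u ∈ T := hfT ▸ Finset.mem_image_of_mem f (Finset.mem_univ u)
      have hi : Function.Injective fun u => g.symm ⟨f u, hmem u⟩ := fun u v h =>
        hfi (congrArg Subtype.val (g.symm.injective h))
      refine ⟨Equiv.ofBijective _ (Finite.injective_iff_bijective.mp hi), Finset.mem_univ _, ?_⟩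
      ext u
      simp [hf₀]
    · intro σ _
      rfl
  rw [key, ← hw f₀ hA0, pow_two]
  have hd := det_apply' (B.submatrix f₀ id)
  calc _ = ∑ σ : Equiv.Perm n, ((Equiv.Perm.sign σ : ℤ) * ∏ u, B.submatrix f₀ id (σ u) u) *
        (B.submatrix f₀ id).det := Finset.sum_congr rfl fun σ _ => ?_
    _ = _ := by rw [← Finset.sum_mul, ← hd]
  have : B.submatrix (f₀ ∘ σ) id = (B.submatrix f₀ id).submatrix σ id := rfl
  rw [this, det_permute]
  simp only [submatrix_apply, id]
  ring

/-- The Cauchy–Binet formula for a Gram determinant, in a form that needs no ordering of the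
index sets: `w T` is the common value of the squares of the minors on the rows `T`. -/
theorem det_transpose_diagInd_mul [Fintype E] (B : Matrix E n ℝ) (S : Finset E)
    (w : Finset E → ℝ)
    (hw : ∀ f : n → E, Function.Injective f →
      (B.submatrix f id).det ^ 2 = w (Finset.univ.image f)) :
    (Bᵀ * diagInd S * B).det = ∑ T ∈ S.powersetCard (Fintype.card n), w T := by
  have hrow : (Bᵀ * diagInd S * B) = fun u => ∑ e ∈ S, B e u • B e := by
    ext u v
    simp [Matrix.mul_apply, diagInd, diagonal_apply, Finset.sum_apply]
  rw [hrow]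
  have h1 := (detRowAlternating (n := n) (R := ℝ)).toMultilinearMap.map_sum_finset
    (fun u e => B e u • B e) (fun _ => S)
  refine h1.trans ?_
  have h2 (f : n → E) : (detRowAlternating (n := n) (R := ℝ)).toMultilinearMap
      (fun u => B (f u) u • B (f u)) = (∏ u, B (f u) u) * (B.submatrix f id).det :=
    (MultilinearMap.map_smul_univ _ _ _).trans rfl
  simp only [h2]
  rw [← Finset.sum_filter_of_ne (p := Function.Injective)]
  · -- group the injective choices of rows by their image
    have hmaps : ∀ f ∈ (Fintype.piFinset fun _ : n => S).filter Function.Injective,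
        Finset.univ.image f ∈ S.powersetCard (Fintype.card n) := by
      intro f hf
      rw [Finset.mem_filter, Fintype.mem_piFinset] at hf
      rw [Finset.mem_powersetCard, Finset.card_image_of_injective _ hf.2, Finset.card_univ]
      exact ⟨Finset.image_subset_iff.mpr fun u _ => hf.1 u, rfl⟩
    rw [← Finset.sum_fiberwise_of_maps_to hmaps]
    refine Finset.sum_congr rfl fun T hT => ?_
    rw [Finset.mem_powersetCard] at hT
    refine sum_injective_image_eq B T hT.2 _ ?_ _ ?_
    · intro f
      simp only [Finset.mem_filter, Fintype.mem_piFinset]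
      refine ⟨fun h => ⟨h.1.2, h.2⟩, fun h => ⟨⟨fun u => hT.1 ?_, h.1⟩, h.2⟩⟩
      exact h.2 ▸ Finset.mem_image_of_mem f (Finset.mem_univ u)
    · intro f hf
      simp only [Finset.mem_filter] at hf
      rw [hw f hf.1.2, hf.2]
  · -- a choice that repeats a row gives a vanishing determinant
    intro f _ hne
    by_contra hf
    obtain ⟨u, v, huv, hne'⟩ : ∃ u v, f u = f v ∧ u ≠ v := by
      simpa [Function.Injective] using hf
    refine hne (by rw [det_zero_of_row_eq hne', mul_zero]; ext; simp [huv])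

end

/-! ### Inclusion–exclusion for determinants -/

section

variable {E : Type*} [DecidableEq E]

/-- The matrix equal to `M` on the rows `F`, to `1 - M` on the rows `G`, and to the identity on the
others. -/
def yesNoMatrix (M : Matrix E E ℝ) (F G : Finset E) : Matrix E E ℝ :=
  of fun e => if e ∈ F then M e else if e ∈ G then (1 : Matrix E E ℝ) e - M e
    else (1 : Matrix E E ℝ) e

/-- Multilinearity in row `f`: the rows `M f` and `1 f - M f` add up to `1 f`. -/
theorem det_yesNoMatrix_insert [Fintype E] (M : Matrix E E ℝ) {F G : Finset E} {f : E}
    (hF : f ∉ F) (hG : f ∉ G) :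
    (yesNoMatrix M (insert f F) G).det + (yesNoMatrix M F (insert f G)).det =
      (yesNoMatrix M F G).det := by
  have h1 : yesNoMatrix M (insert f F) G = (yesNoMatrix M F G).updateRow f (M f) := by
    ext e e'
    rcases eq_or_ne e f with rfl | h <;> simp [yesNoMatrix, updateRow_apply, *]
  have h2 : yesNoMatrix M F (insert f G) =
      (yesNoMatrix M F G).updateRow f ((1 : Matrix E E ℝ) f - M f) := by
    ext e e'
    rcases eq_or_ne e f with rfl | h <;> simp [yesNoMatrix, updateRow_apply, *]
  have h3 : yesNoMatrix M F G = (yesNoMatrix M F G).updateRow f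
      (M f + ((1 : Matrix E E ℝ) f - M f)) := by
    ext e e'
    rcases eq_or_ne e f with rfl | h <;> simp [yesNoMatrix, updateRow_apply, *]
  rw [h1, h2, ← det_updateRow_add, ← h3]

theorem yesNoMatrix_empty [Fintype E] (M : Matrix E E ℝ) (G : Finset E) :
    yesNoMatrix M ∅ G = 1 - diagInd G * M := by
  ext e e'
  by_cases h : e ∈ G <;> simp [yesNoMatrix, diagInd, h]

/-- Weinstein–Aronszajn identity for a transfer-current matrix `B A⁻¹ Bᵀ`. -/
theorem det_yesNoMatrix_empty [Fintype E] {n : Type*} [Fintype n] [DecidableEq n]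
    (A : Matrix n n ℝ) (hA : A.det ≠ 0)
    (B : Matrix E n ℝ) (hAB : A = Bᵀ * B) (G : Finset E) :
    (yesNoMatrix (B * A⁻¹ * Bᵀ) ∅ G).det = A.det⁻¹ * (Bᵀ * diagInd Gᶜ * B).det := by
  have hD : diagInd Gᶜ = 1 - diagInd G := by
    ext e e'
    by_cases h : e ∈ G <;> simp [diagInd, diagonal_apply, one_apply, h]
  have h1 : Bᵀ * diagInd Gᶜ * B = A * (1 + A⁻¹ * Bᵀ * -(diagInd G * B)) := by
    rw [hD, Matrix.mul_add, Matrix.mul_one, ← Matrix.mul_assoc, ← Matrix.mul_assoc,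
      mul_nonsing_inv _ (isUnit_iff_ne_zero.mpr hA), Matrix.one_mul, Matrix.mul_sub,
      Matrix.sub_mul, Matrix.mul_one, ← hAB, Matrix.mul_neg, Matrix.mul_assoc _ (diagInd G),
      sub_eq_add_neg]
  rw [yesNoMatrix_empty, h1, det_mul, inv_mul_cancel_left₀ hA, det_one_add_mul_comm]
  congr 1
  rw [Matrix.neg_mul, sub_eq_add_neg]
  simp only [Matrix.mul_assoc]

/-- The rows outside `F ∪ G` are those of the identity, so only the block on `F ∪ G` matters. -/
theorem det_yesNoMatrix_eq_det_submatrix [Fintype E] (M : Matrix E E ℝ) {F G : Finset E}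
    (h : Disjoint F G) :
    (yesNoMatrix M F G).det =
      ((yesNoMatrix M F G).submatrix (Sum.elim Subtype.val Subtype.val : F ⊕ G → E)
        (Sum.elim Subtype.val Subtype.val)).det := by
  have hinj : Function.Injective (Sum.elim Subtype.val Subtype.val : F ⊕ G → E) := by
    refine Subtype.val_injective.sumElim Subtype.val_injective fun a b hab => ?_
    exact Finset.disjoint_left.mp h a.2 (hab ▸ b.2)
  let p : E → Prop := fun e => e ∈ F ∨ e ∈ G
  rw [twoBlockTriangular_det (yesNoMatrix M F G) p]
  · have hone : toSquareBlockProp (yesNoMatrix M F G) (fun e => ¬ p e) = 1 := by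
      ext e e'
      have := e.2
      simp only [p, not_or] at this
      simp [toSquareBlockProp, yesNoMatrix, this, one_apply, Subtype.ext_iff]
    rw [hone, det_one, mul_one]
    let φ : F ⊕ G ≃ {e // p e} := Equiv.ofBijective
      (fun i => ⟨Sum.elim Subtype.val Subtype.val i, by
        rcases i with i | i
        · exact Or.inl i.2
        · exact Or.inr i.2⟩)
      ⟨fun i j hij => hinj (congrArg Subtype.val hij), by
        rintro ⟨e, he | he⟩
        · exact ⟨Sum.inl ⟨e, he⟩, rfl⟩
        · exact ⟨Sum.inr ⟨e, he⟩, rfl⟩⟩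
    rw [← det_submatrix_equiv_self φ]
    rfl
  · intro e he e' he'
    simp only [p, not_or] at he
    simp only [yesNoMatrix, of_apply, he, if_false]
    exact one_apply_ne (by rintro rfl; exact he'.elim he.1 he.2)

/-- Two functions of disjoint pairs `(F, G)` that satisfy the inclusion–exclusion recursion
coincide as soon as they agree for `F = ∅`. -/
theorem eq_of_insert_recursion (Φ Ψ : Finset E → Finset E → ℝ)
    (hΦ : ∀ F G f, f ∉ F → f ∉ G → Φ (insert f F) G + Φ F (insert f G) = Φ F G)
    (hΨ : ∀ F G f, f ∉ F → f ∉ G → Ψ (insert f F) G + Ψ F (insert f G) = Ψ F G)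
    (h : ∀ G, Φ ∅ G = Ψ ∅ G) (F G : Finset E) (hFG : Disjoint F G) : Φ F G = Ψ F G := by
  induction F using Finset.induction_on generalizing G with
  | empty => exact h G
  | insert f F hf ih =>
    rw [Finset.disjoint_insert_left] at hFG
    have h1 := hΦ F G f hf hFG.1
    have h2 := hΨ F G f hf hFG.1
    have h3 := ih G hFG.2
    have h4 := ih (insert f G) (Finset.disjoint_insert_right.mpr ⟨hf, hFG.2⟩)
    linarith

end

section

open Matrix

variable {W : Type*} {H : SimpleGraph W} {Λ : Finset W}

/-! ### The signed incidence matrix -/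

theorem edge_eq_mk {o : Edge H Λ → H.Dart} (ho : ∀ e, (o e).edge = e.1) (e : Edge H Λ) :
    e.1 = s((o e).fst, (o e).snd) := by
  rw [← ho e]
  rfl

theorem natCard_option : Nat.card (Option Λ) = Fintype.card Λ + 1 := by
  rw [Nat.card_eq_fintype_card, Fintype.card_option]

variable [DecidableEq W]

/-- The coordinate vector of a vertex of the wired graph, the wired vertex being sent to `0`. -/
def vertexVec (Λ : Finset W) (R : Type*) [Ring R] : Option Λ → Λ → R
  | none => 0
  | some v => Pi.single v 1

/-- The signed incidence matrix of the edges oriented by `o`, restricted to the columns `Λ`. -/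
def incidence (o : Edge H Λ → H.Dart) (R : Type*) [Ring R] : Matrix (Edge H Λ) Λ R :=
  of fun e => vertexVec Λ R (wire Λ (o e).snd) - vertexVec Λ R (wire Λ (o e).fst)

theorem wire_coe (v : Λ) : wire Λ (v : W) = some v := by
  simp [wire]

theorem wire_of_mem {v : W} (hv : v ∈ Λ) : wire Λ v = some ⟨v, hv⟩ := dif_pos hv

theorem wire_of_notMem {v : W} (hv : v ∉ Λ) : wire Λ v = none := dif_neg hv

theorem wire_eq_some_iff {v : W} {u : Λ} : wire Λ v = some u ↔ v = u := by
  by_cases hv : v ∈ Λ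
  · rw [wire_of_mem hv, Option.some_inj, Subtype.ext_iff]
  · rw [wire_of_notMem hv]
    refine ⟨fun h => by simp at h, ?_⟩
    rintro rfl
    exact absurd u.2 hv

theorem vertexVec_wire (R : Type*) [Ring R] (v : W) (u : Λ) :
    vertexVec Λ R (wire Λ v) u = if v = u then 1 else 0 := by
  by_cases hv : v ∈ Λ
  · simp [wire_of_mem hv, vertexVec, Pi.single_apply, Subtype.ext_iff, eq_comm]
  · rw [wire_of_notMem hv, if_neg]
    · rfl
    · rintro rfl
      exact hv u.2

theorem vertexVec_dotProduct {R : Type*} [Ring R] (x : Option Λ → R) (hx : x none = 0)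
    (a : Option Λ) : vertexVec Λ R a ⬝ᵥ (fun v => x (some v)) = x a := by
  rcases a with _ | v
  · simp [vertexVec, hx]
  · simp [vertexVec]

theorem incidence_mulVec {R : Type*} [Ring R] (o : Edge H Λ → H.Dart) (x : Option Λ → R)
    (hx : x none = 0) (e : Edge H Λ) :
    (incidence o R *ᵥ fun v => x (some v)) e =
      x (wire Λ (o e).snd) - x (wire Λ (o e).fst) := by
  change (vertexVec Λ R _ - vertexVec Λ R _) ⬝ᵥ _ = _
  rw [sub_dotProduct, vertexVec_dotProduct x hx, vertexVec_dotProduct x hx]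

theorem incidence_map_intCast (o : Edge H Λ → H.Dart) :
    (incidence o ℤ).map (Int.castRingHom ℝ) = incidence o ℝ := by
  ext e v
  simp [incidence, vertexVec_wire]

theorem finite_edge [H.LocallyFinite] : Finite (Edge H Λ) := by
  have h : {e : Sym2 W | e ∈ H.edgeSet ∧ ∃ v ∈ Λ, v ∈ e}.Finite := by
    refine (Λ.finite_toSet.biUnion fun v _ => (H.incidenceFinset v).finite_toSet).subset ?_
    rintro e ⟨he, v, hv, hve⟩
    simp only [Set.mem_iUnion]
    exact ⟨v, hv, by simpa using ⟨he, hve⟩⟩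
  exact h.to_subtype

theorem sum_mem_edge_eq_degree [DecidableRel H.Adj] [H.LocallyFinite] [Fintype (Edge H Λ)] (u : Λ) :
    ∑ e : Edge H Λ, (if (u : W) ∈ e.1 then (1 : ℝ) else 0) = H.degree u := by
  rw [Finset.sum_boole, ← H.card_incidenceFinset_eq_degree,
    ← Finset.card_image_of_injective _ Subtype.val_injective]
  congr 2
  ext e
  simp only [Finset.mem_image, Finset.mem_filter, Finset.mem_univ, true_and,
    SimpleGraph.mem_incidenceFinset, SimpleGraph.incidenceSet, Set.mem_ofPred_eq]
  constructor
  · rintro ⟨e, he, rfl⟩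
    exact ⟨e.2.1, he⟩
  · rintro ⟨he, hu⟩
    exact ⟨⟨e, he, u, u.2, hu⟩, hu, rfl⟩

/-- The Dirichlet Laplacian is the Gram matrix of the columns of the incidence matrix. -/
theorem negLaplacian_eq [DecidableRel H.Adj] [H.LocallyFinite] [Fintype (Edge H Λ)]
    {o : Edge H Λ → H.Dart} (ho : ∀ e, (o e).edge = e.1) :
    negLaplacian H Λ = (incidence o ℝ)ᵀ * incidence o ℝ := by
  ext u v
  rw [Matrix.mul_apply]
  simp only [transpose_apply, incidence, of_apply, Pi.sub_apply, vertexVec_wire, negLaplacian,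
    laplacian]
  by_cases huv : (u : W) = v
  · rw [if_pos huv, neg_neg, ← sum_mem_edge_eq_degree]
    refine Finset.sum_congr rfl fun e _ => ?_
    simp only [edge_eq_mk ho e, ← huv, Sym2.mem_iff]
    have hne := (o e).adj.ne
    grind
  · rw [if_neg huv]
    have hterm (e : Edge H Λ) : ((if (o e).snd = (u : W) then (1 : ℝ) else 0) -
        if (o e).fst = (u : W) then 1 else 0) * ((if (o e).snd = (v : W) then (1 : ℝ) else 0) -
        if (o e).fst = (v : W) then 1 else 0) = if e.1 = s((u : W), v) then -1 else 0 := by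
      simp only [edge_eq_mk ho e, Sym2.eq_iff]
      have hne := (o e).adj.ne
      grind
    rw [Finset.sum_congr rfl fun e _ => hterm e]
    by_cases hadj : H.Adj u v
    · rw [if_pos hadj, Finset.sum_eq_single ⟨s((u : W), v), hadj, u, u.2, by simp⟩]
      · simp
      · intro e _ he
        rw [if_neg]
        exact fun h => he (Subtype.ext h)
      · simp
    · rw [if_neg hadj, neg_zero, Finset.sum_eq_zero]
      intro e _
      rw [if_neg]
      exact fun h => hadj (by simpa [h] using e.2.1)

/-- A harmonic function vanishing outside `Λ` is constant along paths of `H`, hence zero. -/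
theorem det_negLaplacian_ne_zero [DecidableRel H.Adj] [H.LocallyFinite]
    (hΛ : ∀ v ∈ Λ, ∃ w, w ∉ Λ ∧ H.Reachable v w)
    {o : Edge H Λ → H.Dart} (ho : ∀ e, (o e).edge = e.1) :
    (negLaplacian H Λ).det ≠ 0 := by
  have := finite_edge (H := H) (Λ := Λ)
  have := Fintype.ofFinite (Edge H Λ)
  intro hdet
  obtain ⟨x, hx0, hx⟩ := exists_mulVec_eq_zero_iff.mpr hdet
  refine hx0 ?_
  have hBx : incidence o ℝ *ᵥ x = 0 := by
    have h := ker_mulVecLin_transpose_mul_self (incidence o ℝ)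
    rw [← negLaplacian_eq ho] at h
    have hmem : x ∈ (negLaplacian H Λ).mulVecLin.ker := by simpa using hx
    rw [h] at hmem
    simpa using hmem
  -- the extension of `x` by zero outside `Λ`, read on the wired vertices
  let y : Option Λ → ℝ := fun a => a.elim 0 x
  have hy (e : Edge H Λ) : y (wire Λ (o e).snd) = y (wire Λ (o e).fst) :=
    sub_eq_zero.mp ((incidence_mulVec o y rfl e).symm.trans (congrFun hBx e))
  have hadj (a b : W) (hab : H.Adj a b) : y (wire Λ a) = y (wire Λ b) := by
    by_cases h : a ∈ Λ ∨ b ∈ Λ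
    · have he : ∃ v ∈ Λ, v ∈ s(a, b) := by
        rcases h with h | h
        · exact ⟨a, h, by simp⟩
        · exact ⟨b, h, by simp⟩
      have h1 := hy ⟨s(a, b), hab, he⟩
      have h2 := edge_eq_mk ho ⟨s(a, b), hab, he⟩
      rcases Sym2.eq_iff.mp h2 with ⟨ha, hb⟩ | ⟨ha, hb⟩
      · rw [← ha, ← hb] at h1
        exact h1.symm
      · rw [← ha, ← hb] at h1
        exact h1
    · rw [not_or] at h
      rw [wire_of_notMem h.1, wire_of_notMem h.2]
  have hwalk (a b : W) (hab : H.Reachable a b) : y (wire Λ a) = y (wire Λ b) := by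
    obtain ⟨p⟩ := hab
    induction p with
    | nil => rfl
    | cons h _ ih => exact (hadj _ _ h).trans ih
  funext v
  obtain ⟨w, hw, hvw⟩ := hΛ v v.2
  have h := hwalk v w hvw
  rw [wire_coe, wire_of_notMem hw] at h
  exact h

/-! ### Minors of the incidence matrix and spanning trees -/

theorem wire_fst_ne_snd {o : Edge H Λ → H.Dart} (ho : ∀ e, (o e).edge = e.1) (e : Edge H Λ) :
    wire Λ (o e).fst ≠ wire Λ (o e).snd := by
  intro h
  obtain ⟨v, hv, hve⟩ := e.2.2
  have hne := (o e).adj.ne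
  rw [edge_eq_mk ho e, Sym2.mem_iff] at hve
  rcases hve with rfl | rfl
  · rw [wire_of_mem hv, eq_comm, wire_eq_some_iff] at h
    exact hne h.symm
  · rw [wire_of_mem hv, wire_eq_some_iff] at h
    exact hne h

theorem edgeSet_wiredGraph {o : Edge H Λ → H.Dart} (ho : ∀ e, (o e).edge = e.1)
    (T : Set (Edge H Λ)) :
    (wiredGraph H Λ T).edgeSet = (fun e : Edge H Λ => e.1.map (wire Λ)) '' T := by
  ext z
  induction z using Sym2.ind with
  | _ a b =>
    rw [SimpleGraph.mem_edgeSet]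
    refine ⟨fun h => h.2, ?_⟩
    rintro ⟨e, he, hab⟩
    refine ⟨?_, e, he, hab⟩
    rintro rfl
    have h := wire_fst_ne_snd ho e
    dsimp only at hab
    rw [edge_eq_mk ho e, Sym2.map_mk, Sym2.eq_iff] at hab
    rcases hab with ⟨h1, h2⟩ | ⟨h1, h2⟩ <;> exact h (h1.trans h2.symm)

theorem wiredGraph_adj_of_mem {o : Edge H Λ → H.Dart} (ho : ∀ e, (o e).edge = e.1)
    {T : Set (Edge H Λ)} {e : Edge H Λ} (he : e ∈ T) :
    (wiredGraph H Λ T).Adj (wire Λ (o e).fst) (wire Λ (o e).snd) :=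
  ⟨wire_fst_ne_snd ho e, e, he, by rw [edge_eq_mk ho e, Sym2.map_mk]⟩

theorem IsWiredSpanningTree.ncard_eq {o : Edge H Λ → H.Dart} (ho : ∀ e, (o e).edge = e.1)
    {T : Set (Edge H Λ)} (hT : IsWiredSpanningTree H Λ T) : T.ncard = Fintype.card Λ := by
  have h := (SimpleGraph.isTree_iff_connected_and_card.mp hT.2).2
  rw [natCard_option, edgeSet_wiredGraph ho, Nat.card_coe_set_eq,
    hT.1.ncard_image] at h
  omega

/-- A connected set of `|Λ|` edges has no edge to spare, so it is a spanning tree. -/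
theorem isWiredSpanningTree_of_connected {o : Edge H Λ → H.Dart} (ho : ∀ e, (o e).edge = e.1)
    {T : Set (Edge H Λ)} (hfin : T.Finite) (hT : T.ncard = Fintype.card Λ)
    (hc : (wiredGraph H Λ T).Connected) : IsWiredSpanningTree H Λ T := by
  -- connectedness forces at least `|Λ|` edges in the underlying simple graph
  have h := hc.card_vert_le_card_edgeSet_add_one
  rw [natCard_option, edgeSet_wiredGraph ho, Nat.card_coe_set_eq] at h
  have hle := Set.ncard_image_le (f := fun e : Edge H Λ => e.1.map (wire Λ)) hfin
  have heq : ((fun e : Edge H Λ => e.1.map (wire Λ)) '' T).ncard = T.ncard := by omega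
  refine ⟨Set.injOn_of_ncard_image_eq heq hfin,
    SimpleGraph.isTree_iff_connected_and_card.mpr ⟨hc, ?_⟩⟩
  rw [natCard_option, edgeSet_wiredGraph ho, Nat.card_coe_set_eq, heq, hT]

/-- If the edges `T` connect the wired graph, then every coordinate vector is an integral
combination of the rows `T` of the incidence matrix: add up the rows along a path to the root. -/
theorem vertexVec_sub_mem_span {o : Edge H Λ → H.Dart} (ho : ∀ e, (o e).edge = e.1)
    {T : Set (Edge H Λ)} {a b : Option Λ} (h : (wiredGraph H Λ T).Reachable a b) :
    vertexVec Λ ℤ a - vertexVec Λ ℤ b ∈ Submodule.span ℤ (incidence o ℤ '' T) := by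
  obtain ⟨p⟩ := h
  induction p with
  | nil => simp
  | @cons a b c hab _ ih =>
    rw [← sub_add_sub_cancel _ (vertexVec Λ ℤ b)]
    refine add_mem ?_ ih
    obtain ⟨-, e, he, hab⟩ := hab
    have hrow : incidence o ℤ e ∈ Submodule.span ℤ (incidence o ℤ '' T) :=
      Submodule.subset_span ⟨e, he, rfl⟩
    rw [edge_eq_mk ho e, Sym2.map_mk, Sym2.eq_iff] at hab
    rcases hab with ⟨rfl, rfl⟩ | ⟨rfl, rfl⟩
    · have h := neg_mem hrow
      rwa [show -incidence o ℤ e = _ from neg_sub _ _] at h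
    · exact hrow

/-- The integral combinations of `vertexVec_sub_mem_span` form a left inverse over `ℤ`. -/
theorem isUnit_det_incidence_submatrix {o : Edge H Λ → H.Dart} (ho : ∀ e, (o e).edge = e.1)
    (f : Λ → Edge H Λ) (hc : (wiredGraph H Λ (Set.range f)).Connected) :
    IsUnit ((incidence o ℤ).submatrix f id).det := by
  have h (v : Λ) : ∃ c : Λ → ℤ, ∑ u, c u • incidence o ℤ (f u) = Pi.single v 1 := by
    have h := vertexVec_sub_mem_span ho (hc (some v) none)
    rw [show (incidence o ℤ : Edge H Λ → Λ → ℤ) '' Set.range f =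
      Set.range fun u => incidence o ℤ (f u) from (Set.range_comp _ _).symm] at h
    simpa [vertexVec] using (Submodule.mem_span_range_iff_exists_fun ℤ).mp h
  choose P hP using h
  refine isUnit_det_of_left_inverse (B := of P) ?_
  ext v w
  have h := congrFun (hP v) w
  simpa [Matrix.mul_apply, one_apply, Pi.single_apply, eq_comm] using h

/-- If the edges `f` do not connect the wired graph, the indicator of the vertices that they do
not join to the root is in the kernel. -/
theorem det_incidence_submatrix_eq_zero {o : Edge H Λ → H.Dart} (ho : ∀ e, (o e).edge = e.1)
    (f : Λ → Edge H Λ) (hc : ¬ (wiredGraph H Λ (Set.range f)).Connected) :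
    ((incidence o ℤ).submatrix f id).det = 0 := by
  classical
  set Γ := wiredGraph H Λ (Set.range f) with hΓ
  obtain ⟨v, hv⟩ : ∃ v : Λ, ¬ Γ.Reachable (some v) none := by
    by_contra! h
    have h' (a : Option Λ) : Γ.Reachable a none := by
      rcases a with _ | v
      · rfl
      · exact h v
    exact hc ((SimpleGraph.connected_iff _).mpr
      ⟨fun a b => (h' a).trans (h' b).symm, inferInstance⟩)
  let x : Option Λ → ℤ := fun a => if Γ.Reachable a none then 0 else 1
  refine exists_mulVec_eq_zero_iff.mp ⟨fun v => x (some v), ?_, ?_⟩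
  · intro h
    have h := congrFun h v
    simp [x, hv] at h
  · funext u
    refine (incidence_mulVec o x (if_pos (SimpleGraph.Reachable.refl none)) (f u)).trans ?_
    have hadj : Γ.Adj _ _ := wiredGraph_adj_of_mem ho (Set.mem_range_self u)
    have hiff : Γ.Reachable (wire Λ (o (f u)).snd) none ↔
        Γ.Reachable (wire Λ (o (f u)).fst) none :=
      ⟨fun h => hadj.reachable.trans h, fun h => hadj.symm.reachable.trans h⟩
    simp [x, hiff]

open Classical in
/-- A maximal minor of the incidence matrix is `±1` on spanning trees and `0` on all other sets of
edges. -/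
theorem det_incidence_submatrix_sq {o : Edge H Λ → H.Dart} (ho : ∀ e, (o e).edge = e.1)
    (f : Λ → Edge H Λ) (hf : Function.Injective f) :
    ((incidence o ℝ).submatrix f id).det ^ 2 =
      if IsWiredSpanningTree H Λ (Finset.univ.image f : Finset (Edge H Λ)) then 1 else 0 := by
  have hcast : ((incidence o ℝ).submatrix f id).det =
      (((incidence o ℤ).submatrix f id).det : ℤ) := by
    rw [← incidence_map_intCast, ← eq_intCast (Int.castRingHom ℝ), RingHom.map_det]
    rfl
  rw [hcast, Finset.coe_image, Finset.coe_univ, Set.image_univ]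
  by_cases hc : (wiredGraph H Λ (Set.range f)).Connected
  · have hT : IsWiredSpanningTree H Λ (Set.range f) :=
      isWiredSpanningTree_of_connected ho (Set.finite_range f)
        (by rw [← Set.image_univ, Set.ncard_image_of_injective _ hf, Set.ncard_univ,
          Nat.card_eq_fintype_card]) hc
    rw [if_pos hT]
    rcases Int.isUnit_iff.mp (isUnit_det_incidence_submatrix ho f hc) with h | h <;> simp [h]
  · rw [if_neg fun hT => hc hT.2.connected, det_incidence_submatrix_eq_zero ho f hc]
    simp

open Classical in
/-- The matrix-tree theorem for the wired graph with edge set `S`. -/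
theorem det_eq_card_spanningTrees [Fintype (Edge H Λ)] {o : Edge H Λ → H.Dart}
    (ho : ∀ e, (o e).edge = e.1) (S : Finset (Edge H Λ)) :
    ((incidence o ℝ)ᵀ * diagInd S * incidence o ℝ).det =
      ((S.powerset.filter fun T : Finset (Edge H Λ) =>
        IsWiredSpanningTree H Λ (T : Set (Edge H Λ))).card : ℝ) := by
  rw [det_transpose_diagInd_mul _ _ (fun T => if IsWiredSpanningTree H Λ T then 1 else 0)
    (det_incidence_submatrix_sq ho), Finset.sum_boole]
  refine congrArg (fun A : Finset (Finset (Edge H Λ)) => (A.card : ℝ)) ?_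
  ext T
  simp only [Finset.mem_filter, Finset.mem_powersetCard, Finset.mem_powerset]
  refine ⟨fun h => ⟨h.1.1, h.2⟩, fun h => ⟨⟨h.1, ?_⟩, h.2⟩⟩
  rw [← Set.ncard_coe_finset, h.2.ncard_eq ho]

end

section

open Matrix

variable {W : Type*} [DecidableEq W] {H : SimpleGraph W} {Λ : Finset W}

/-! ### The transfer-current matrix -/

theorem green_eq [DecidableRel H.Adj] [H.LocallyFinite] (a b : W) :
    green H Λ a b = vertexVec Λ ℝ (wire Λ a) ⬝ᵥ (negLaplacian H Λ)⁻¹ *ᵥ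
      vertexVec Λ ℝ (wire Λ b) := by
  by_cases ha : a ∈ Λ
  · by_cases hb : b ∈ Λ
    · simp [green, wire_of_mem, ha, hb, vertexVec]
    · simp [green, wire_of_notMem, hb, vertexVec]
  · simp [green, wire_of_notMem, ha, vertexVec]

theorem transferCurrent_eq [DecidableRel H.Adj] [H.LocallyFinite] (o : Edge H Λ → H.Dart)
    (e e' : Edge H Λ) :
    transferCurrent H Λ (o e) (o e') =
      (incidence o ℝ * (negLaplacian H Λ)⁻¹ * (incidence o ℝ)ᵀ) e e' := by
  have h : (incidence o ℝ * (negLaplacian H Λ)⁻¹ * (incidence o ℝ)ᵀ) e e' =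
      (vertexVec Λ ℝ (wire Λ (o e).snd) - vertexVec Λ ℝ (wire Λ (o e).fst)) ⬝ᵥ
        (negLaplacian H Λ)⁻¹ *ᵥ
        (vertexVec Λ ℝ (wire Λ (o e').snd) - vertexVec Λ ℝ (wire Λ (o e').fst)) := by
    rw [Matrix.mul_assoc]
    rfl
  rw [h, sub_dotProduct, mulVec_sub, dotProduct_sub, dotProduct_sub, ← green_eq, ← green_eq,
    ← green_eq, ← green_eq, transferCurrent]
  ring

theorem det_modifiedTransferCurrent [DecidableRel H.Adj] [H.LocallyFinite]
    [Fintype (Edge H Λ)] (o : Edge H Λ → H.Dart) {F G : Finset (Edge H Λ)}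
    (hFG : Disjoint F G) :
    (modifiedTransferCurrent H Λ o F G).det =
      (yesNoMatrix (incidence o ℝ * (negLaplacian H Λ)⁻¹ * (incidence o ℝ)ᵀ) F G).det := by
  rw [det_yesNoMatrix_eq_det_submatrix _ hFG]
  congr 1
  ext i j
  rcases i with i | i
  · simp [modifiedTransferCurrent, yesNoMatrix, transferCurrent_eq]
  · have hi : (i : Edge H Λ) ∉ F := Finset.disjoint_right.mp hFG i.2
    rcases j with j | j
    · have hne : (i : Edge H Λ) ≠ j := by
        intro h
        exact hi (h ▸ j.2)
      simp [modifiedTransferCurrent, yesNoMatrix, transferCurrent_eq, hi, hne]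
    · obtain rfl | hij := eq_or_ne i j
      · simp [modifiedTransferCurrent, yesNoMatrix, transferCurrent_eq, hi]
      · have hne : (i : Edge H Λ) ≠ j := fun h => hij (Subtype.ext h)
        simp [modifiedTransferCurrent, yesNoMatrix, transferCurrent_eq, hi, hij, hne]

/-! ### Fermionic observables -/

theorem psi_sub_psi (o : Edge H Λ → H.Dart) (e : Edge H Λ) :
    psi Λ (o e).snd - psi Λ (o e).fst = ∑ u : Λ, incidence o ℝ e u • gen (Sum.inl u) := by
  have h (v : W) : psi Λ v = ∑ u : Λ, vertexVec Λ ℝ (wire Λ v) u • gen (Sum.inl u) := by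
    by_cases hv : v ∈ Λ
    · simp [psi, hv, wire_of_mem, vertexVec, Pi.single_apply]
    · simp [psi, hv, wire_of_notMem, vertexVec]
  rw [h, h, ← Finset.sum_sub_distrib]
  exact Finset.sum_congr rfl fun u _ => (sub_smul _ _ _).symm

theorem psiBar_sub_psiBar (o : Edge H Λ → H.Dart) (e : Edge H Λ) :
    psiBar Λ (o e).snd - psiBar Λ (o e).fst =
      ∑ u : Λ, incidence o ℝ e u • gen (Sum.inr u) := by
  have h (v : W) : psiBar Λ v = ∑ u : Λ, vertexVec Λ ℝ (wire Λ v) u • gen (Sum.inr u) := by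
    by_cases hv : v ∈ Λ
    · simp [psiBar, hv, wire_of_mem, vertexVec, Pi.single_apply]
    · simp [psiBar, hv, wire_of_notMem, vertexVec]
  rw [h, h, ← Finset.sum_sub_distrib]
  exact Finset.sum_congr rfl fun u _ => (sub_smul _ _ _).symm

/-- The `ζ`-observables of the edges `S` add up to the action of the graph with edge set `S`. -/
theorem sum_zeta [Fintype (Edge H Λ)] (o : Edge H Λ → H.Dart) (S : Finset (Edge H Λ)) :
    ∑ e ∈ S, zeta H Λ (o e) = action ((incidence o ℝ)ᵀ * diagInd S * incidence o ℝ) := by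
  have h (u v : Λ) : ((incidence o ℝ)ᵀ * diagInd S * incidence o ℝ) u v =
      ∑ e ∈ S, incidence o ℝ e u * incidence o ℝ e v := by
    simp [Matrix.mul_apply, diagInd, diagonal_apply]
  simp only [action, h, Finset.sum_smul, zeta, psi_sub_psi, psiBar_sub_psiBar,
    Finset.sum_mul_sum, smul_mul_smul_comm]
  rw [Finset.sum_comm]
  exact Finset.sum_congr rfl fun u _ => Finset.sum_comm

theorem zeta_sq (e : H.Dart) : zeta H Λ e * zeta H Λ e = 0 := by
  obtain ⟨x₁, h₁⟩ := psi_eq_ι Λ e.snd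
  obtain ⟨x₂, h₂⟩ := psi_eq_ι Λ e.fst
  obtain ⟨y₁, k₁⟩ := psiBar_eq_ι Λ e.snd
  obtain ⟨y₂, k₂⟩ := psiBar_eq_ι Λ e.fst
  rw [zeta, h₁, h₂, k₁, k₂, ← map_sub, ← map_sub]
  exact ι_mul_ι_sq _ _

theorem isNilpotent_sum_zeta (o : Edge H Λ → H.Dart) (S : Finset (Edge H Λ)) :
    IsNilpotent (∑ e ∈ S, zeta H Λ (o e)) :=
  Commute.isNilpotent_sum (fun _ _ => isNilpotent_of_sq_eq_zero (zeta_sq _))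
    fun _ _ _ _ => zeta_commute H Λ _ _

/-- Multiplying the Gaussian by `∏_{g ∈ G} (1 - ζ(g))` removes the edges `G` from the action. -/
theorem exp_mul_yesNoObservable_empty [DecidableRel H.Adj] [H.LocallyFinite]
    [Fintype (Edge H Λ)] {o : Edge H Λ → H.Dart} (ho : ∀ e, (o e).edge = e.1)
    (G : Finset (Edge H Λ)) :
    IsNilpotent.exp (fermionicAction H Λ) * yesNoObservable H Λ o ∅ G =
      IsNilpotent.exp (action ((incidence o ℝ)ᵀ * diagInd Gᶜ * incidence o ℝ)) := by
  have h1 : yesNoObservable H Λ o ∅ G = IsNilpotent.exp (-∑ e ∈ G, zeta H Λ (o e)) := by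
    rw [← Finset.sum_neg_distrib, exp_sum_eq_noncommProd (fun e => -zeta H Λ (o e))
      (fun e e' => ((zeta_commute H Λ _ _).neg_left).neg_right)
      (fun e => by rw [neg_mul_neg, zeta_sq]) G
      (fun _ _ _ _ _ => commute_one_add ((zeta_commute H Λ _ _).neg_left).neg_right)]
    exact (congrArg₂ (· * ·) (Finset.noncommProd_empty _ _)
      (Finset.noncommProd_congr rfl (fun e _ => sub_eq_add_neg _ _) _)).trans (one_mul _)
  have h2 : fermionicAction H Λ = ∑ e, zeta H Λ (o e) := by
    rw [sum_zeta, show diagInd (Finset.univ : Finset (Edge H Λ)) = 1 by simp [diagInd],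
      Matrix.mul_one, ← negLaplacian_eq ho]
    rfl
  have hcomm : Commute (∑ e, zeta H Λ (o e)) (-∑ e ∈ G, zeta H Λ (o e)) :=
    (Commute.sum_left _ _ _ fun _ _ => Commute.sum_right _ _ _ fun _ _ =>
      zeta_commute H Λ _ _).neg_right
  rw [h1, h2, ← IsNilpotent.exp_add_of_commute hcomm (isNilpotent_sum_zeta o _)
    (isNilpotent_sum_zeta o _).neg, ← sum_zeta, ← Finset.sum_add_sum_compl G]
  congr 1
  abel

theorem fGFF_yesNoObservable_empty [DecidableRel H.Adj] [H.LocallyFinite]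
    [Fintype (Edge H Λ)] {o : Edge H Λ → H.Dart} (ho : ∀ e, (o e).edge = e.1)
    (G : Finset (Edge H Λ)) :
    fGFF H Λ (yesNoObservable H Λ o ∅ G) = (negLaplacian H Λ).det⁻¹ *
      ((incidence o ℝ)ᵀ * diagInd Gᶜ * incidence o ℝ).det := by
  rw [fGFF, exp_mul_yesNoObservable_empty ho, berezin_exp_action]

theorem fGFF_add [DecidableRel H.Adj] [H.LocallyFinite] (X Y : Grassmann Λ) :
    fGFF H Λ (X + Y) = fGFF H Λ X + fGFF H Λ Y := by
  simp only [fGFF, mul_add, map_add]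

/-- The factors `ζ(f)` and `1 - ζ(f)` add up to `1`. -/
theorem yesNoObservable_insert (o : Edge H Λ → H.Dart) {F G : Finset (Edge H Λ)} {f : Edge H Λ}
    (hF : f ∉ F) (hG : f ∉ G) :
    yesNoObservable H Λ o (insert f F) G + yesNoObservable H Λ o F (insert f G) =
      yesNoObservable H Λ o F G := by
  have h1 : yesNoObservable H Λ o (insert f F) G = _ * zeta H Λ (o f) * _ :=
    congrArg (· * _) (Finset.noncommProd_insert_of_notMem' F f _ _ hF)
  have h2 : yesNoObservable H Λ o F (insert f G) = _ * ((1 - zeta H Λ (o f)) * _) :=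
    congrArg (_ * ·) (Finset.noncommProd_insert_of_notMem G f _ _ hG)
  rw [h1, h2, ← mul_assoc, ← add_mul, ← mul_add, add_sub_cancel, mul_one]
  rfl

/-! ### Counting spanning trees -/

theorem ust_real_eq [Finite (Edge H Λ)] (X : Set (Set (Edge H Λ))) :
    (ust H Λ).real X = ({T | IsWiredSpanningTree H Λ T}.ncard : ℝ)⁻¹ *
      ({T | IsWiredSpanningTree H Λ T} ∩ X).ncard := by
  have hfin (Y : Set (Set (Edge H Λ))) : Y.Finite := Set.toFinite Y
  have hcard (Y : Set (Set (Edge H Λ))) : (Y.encard : ENNReal).toReal = Y.ncard := by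
    rw [← (hfin Y).cast_ncard_eq, ENat.toENNReal_coe, ENNReal.toReal_natCast]
  rw [ust, ProbabilityTheory.uniformOn, MeasureTheory.measureReal_def,
    ProbabilityTheory.cond_apply (hfin _).measurableSet, ENNReal.toReal_mul, ENNReal.toReal_inv,
    MeasureTheory.Measure.count_apply (hfin _).measurableSet,
    MeasureTheory.Measure.count_apply (hfin _).measurableSet, hcard, hcard]

/-- The number of spanning trees that contain `F` and avoid `G`. -/
def treeCount (H : SimpleGraph W) (Λ : Finset W) (F G : Finset (Edge H Λ)) : ℕ :=
  {T | IsWiredSpanningTree H Λ T ∧ (F : Set (Edge H Λ)) ⊆ T ∧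
    (G : Set (Edge H Λ)) ∩ T = ∅}.ncard

/-- A spanning tree either contains `f` or avoids it. -/
theorem treeCount_insert [Finite (Edge H Λ)] (F G : Finset (Edge H Λ)) (f : Edge H Λ) :
    treeCount H Λ (insert f F) G + treeCount H Λ F (insert f G) = treeCount H Λ F G := by
  rw [treeCount, treeCount, treeCount, ← Set.ncard_union_eq]
  · congr 1
    ext T
    simp only [Set.mem_union, Set.mem_ofPred_eq, Finset.coe_insert, Set.insert_subset_iff,
      ← Set.disjoint_iff_inter_eq_empty, Set.disjoint_insert_left]
    tauto
  · rw [Set.disjoint_left]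
    rintro T ⟨-, hT, -⟩ ⟨-, -, hT'⟩
    have hmem : f ∈ ((insert f G : Finset (Edge H Λ)) : Set (Edge H Λ)) ∩ T :=
      ⟨by simp, hT (by simp)⟩
    rw [hT'] at hmem
    exact hmem

theorem treeCount_empty [Fintype (Edge H Λ)] {o : Edge H Λ → H.Dart}
    (ho : ∀ e, (o e).edge = e.1) (G : Finset (Edge H Λ)) :
    (treeCount H Λ ∅ G : ℝ) = ((incidence o ℝ)ᵀ * diagInd Gᶜ * incidence o ℝ).det := by
  classical
  rw [det_eq_card_spanningTrees ho, treeCount, ← Set.ncard_coe_finset,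
    ← Set.ncard_image_of_injective _ Finset.coe_injective]
  congr 2
  ext T
  simp only [Set.mem_ofPred_eq, Set.mem_image, Finset.coe_filter, Finset.mem_powerset,
    ← Set.disjoint_iff_inter_eq_empty]
  constructor
  · rintro ⟨hT, -, hG⟩
    refine ⟨T.toFinset, ⟨?_, by simpa using hT⟩, by simp⟩
    intro e he
    rw [Finset.mem_compl]
    exact fun h => Set.disjoint_left.mp hG h (by simpa using he)
  · rintro ⟨T, ⟨hG, hT⟩, rfl⟩
    refine ⟨hT, by simp, Set.disjoint_left.mpr fun e he heT => ?_⟩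
    exact Finset.mem_compl.mp (hG heT) he

theorem ust_real_eq_treeCount [Finite (Edge H Λ)] (F G : Finset (Edge H Λ)) :
    (ust H Λ).real {T | (F : Set (Edge H Λ)) ⊆ T ∧ (G : Set (Edge H Λ)) ∩ T = ∅} =
      (treeCount H Λ ∅ ∅ : ℝ)⁻¹ * treeCount H Λ F G := by
  rw [ust_real_eq, treeCount, treeCount]
  simp [Set.ofPred_and]

end

end

end FermionicUST

open FermionicUST
theorem mainTheorem2 {W : Type*} [DecidableEq W] (H : SimpleGraph W) [DecidableRel H.Adj]
    [H.LocallyFinite] (Λ : Finset W)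
    (hΛ : ∀ v ∈ Λ, ∃ w, w ∉ Λ ∧ H.Reachable v w)
    (o : Edge H Λ → H.Dart) (ho : ∀ e, (o e).edge = e.1)
    (F G : Finset (Edge H Λ)) (hFG : Disjoint F G) :
    (ust H Λ).real {T | (F : Set (Edge H Λ)) ⊆ T ∧ (G : Set (Edge H Λ)) ∩ T = ∅}
        = fGFF H Λ (yesNoObservable H Λ o F G) ∧
    fGFF H Λ (yesNoObservable H Λ o F G) = (modifiedTransferCurrent H Λ o F G).det := by
  have := finite_edge (H := H) (Λ := Λ)
  have := Fintype.ofFinite (Edge H Λ)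
  have hdet := det_negLaplacian_ne_zero hΛ ho
  have hcount : (treeCount H Λ ∅ ∅ : ℝ) = (negLaplacian H Λ).det := by
    rw [treeCount_empty ho, Finset.compl_empty,
      show diagInd (Finset.univ : Finset (Edge H Λ)) = 1 by simp [diagInd], Matrix.mul_one,
      ← negLaplacian_eq ho]
  have hrec (F G : Finset (Edge H Λ)) (f : Edge H Λ) (hF : f ∉ F) (hG : f ∉ G) :
      fGFF H Λ (yesNoObservable H Λ o (insert f F) G) +
        fGFF H Λ (yesNoObservable H Λ o F (insert f G)) =
      fGFF H Λ (yesNoObservable H Λ o F G) := by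
    rw [← fGFF_add, yesNoObservable_insert o hF hG]
  constructor
  · rw [ust_real_eq_treeCount, hcount]
    refine eq_of_insert_recursion
      (fun F G => (negLaplacian H Λ).det⁻¹ * (treeCount H Λ F G : ℝ))
      (fun F G => fGFF H Λ (yesNoObservable H Λ o F G)) ?_ hrec ?_ F G hFG
    · intro F G f _ _
      rw [← mul_add, ← Nat.cast_add, treeCount_insert]
    · intro G
      rw [fGFF_yesNoObservable_empty ho, treeCount_empty ho]
  · rw [det_modifiedTransferCurrent o hFG]
    refine eq_of_insert_recursion (fun F G => fGFF H Λ (yesNoObservable H Λ o F G))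
      (fun F G => (yesNoMatrix (incidence o ℝ * (negLaplacian H Λ)⁻¹ * (incidence o ℝ).transpose)
        F G).det) hrec (fun F G f hF hG => det_yesNoMatrix_insert _ hF hG) ?_ F G hFG
    intro G
    rw [fGFF_yesNoObservable_empty ho, det_yesNoMatrix_empty _ hdet _ (negLaplacian_eq ho)]
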